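/- Let $q>1$ be real, let $[n]_q=1+q+\dots+q^{n-1}$, $[n]_q^!=[1]_q[2]_q\cdots[n]_q$ (with $[0]_q^!=1$), and let $\exp_q(z)=\sum_{n\ge0}z^n/[n]_q^!$. For a function $g$ holomorphic near $0$ let $$D_qg(z)=\frac{g(qz)-g(z)}{qz-z},\qquad D_{1,q}g(z)=\frac{g(z)-g(qz)}{z-qz}\qquad(z\ne0),\qquad D_qg(0)=D_{1,q}g(0)=g'(0),$$ be the Jackson $q$-derivative and the $(1,q)$-derivative, and let $\partial_{m_2,z}$ be the moment derivative for $m_2=([n]_q^!)_{n\ge0}$, i.e. the operator $\sum_{n\ge0} a_nz^n\mapsto\sum_{n\ge0}[n+1]_q\,a_{n+1}z^n$ on power series, applied to holomorphic functions through their Maclaurin series. Let $f$ be holomorphic on $D(0,r)$, $0<\varepsilon<r$, $k\in\mathbb{N}_0$ and $|z|<q^{-k}\varepsilon$. For $\theta\in\mathbb{R}$ put $L_\theta=[0,\infty)e^{i\theta}$. (i) For every $\omega$ with $|\omega|=\varepsilon$ and every $\theta\in\mathbb{R}$ with $\arg\omega+\theta\not\equiv\pi\pmod{2\pi}$, the integral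 $\int_{L_\theta}\zeta^k\frac{\exp_q(z\zeta)}{\exp_q(q\omega\zeta)}\,d\zeta$ converges absolutely. (ii) Let $\theta=\theta(\omega)$ be any choice of directions on the circle $|\omega|=\varepsilon$ such that $\arg\omega+\theta(\omega)\not\equiv\pi\pmod{2\pi}$ for all but at most countably many $\omega$ (for instance a constant $\theta$, for which exactly one $\omega$ is excluded). Then the outer integrand below is integrable over the circle, the power series $\partial_{m_2,z}^kf$ converges at $z$, and $$D_q^kf(z)=D_{1,q}^kf(z)=\partial_{m_2,z}^kf(z)=\frac{q-1}{2\pi i\log q}\oint_{|\omega|=\varepsilon}f(\omega)\int_{L_{\theta}}\zeta^k\frac{\exp_q(z\zeta)}{\exp_q(q\omega\zeta)}\,d\zeta\,d\omega .$$ -/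

import Mathlib

noncomputable section

/-- The `q`-number `[n]_q = 1 + q + ⋯ + q^(n-1)`. -/
def qNumber (q : ℝ) (n : ℕ) : ℝ := ∑ j ∈ Finset.range n, q ^ j

/-- The `q`-factorial `[n]_q^! = [1]_q [2]_q ⋯ [n]_q`. -/
def qFactorial (q : ℝ) (n : ℕ) : ℝ := ∏ j ∈ Finset.range n, qNumber q (j + 1)

/-- The `q`-exponential `exp_q(z) = ∑ z^n / [n]_q^!` (an entire function for `q > 1`). -/
def qExp (q : ℝ) (z : ℂ) : ℂ := ∑' n : ℕ, z ^ n / (qFactorial q n : ℂ)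

/-- Jackson's `q`-derivative, extended to the origin by its limit `f'(0)`. -/
def jacksonDeriv (q : ℝ) (f : ℂ → ℂ) (z : ℂ) : ℂ :=
  if z = 0 then deriv f 0 else (f (q * z) - f z) / (q * z - z)

/-- The `(p,q)`-derivative, extended to the origin by its limit `f'(0)`. -/
def pqDeriv (p q : ℝ) (f : ℂ → ℂ) (z : ℂ) : ℂ :=
  if z = 0 then deriv f 0 else (f (p * z) - f (q * z)) / (p * z - q * z)

/-- The formal moment derivative `∑ aₙ zⁿ ↦ ∑ (m(n+1)/m(n)) aₙ₊₁ zⁿ`. -/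
def momentDeriv (m : ℕ → ℝ) (a : PowerSeries ℂ) : PowerSeries ℂ :=
  PowerSeries.mk fun n => ((m (n + 1) / m n : ℝ) : ℂ) * PowerSeries.coeff (n + 1) a

/-- The Maclaurin series of `f`. -/
def maclaurin (f : ℂ → ℂ) : PowerSeries ℂ :=
  PowerSeries.mk fun n => iteratedDeriv n f 0 / (n.factorial : ℂ)

/-- `g` is absolutely integrable along the ray `L_θ = [0,∞) e^{iθ}`. -/
def RayIntegrable (θ : ℝ) (g : ℂ → ℂ) : Prop :=
  MeasureTheory.IntegrableOn
    (fun s : ℝ => g (s * Complex.exp (θ * Complex.I))) (Set.Ioi 0)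

/-- The integral of `g` along the ray `L_θ = [0,∞) e^{iθ}`, with `ζ = s e^{iθ}`. -/
def rayIntegral (θ : ℝ) (g : ℂ → ℂ) : ℂ :=
  ∫ s in Set.Ioi (0 : ℝ), g (s * Complex.exp (θ * Complex.I)) * Complex.exp (θ * Complex.I)

/-- The condition `arg ω + θ ≠ ±π`, modulo `2π`. -/
def Admissible (ω : ℂ) (θ : ℝ) : Prop :=
  ((Complex.arg ω + θ : ℝ) : Real.Angle) ≠ (Real.pi : Real.Angle)

/-- The kernel `ζ^k exp_q(zζ) / exp_q(qωζ)`. -/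
def qKernel (q : ℝ) (k : ℕ) (z ω ζ : ℂ) : ℂ :=
  ζ ^ k * (qExp q (z * ζ) / qExp q (q * ω * ζ))

/-- The double integral
`(q-1)/(2πi log q) ∮_{|ω|=ε} f(ω) ∫_{L_{θ(ω)}} ζ^k exp_q(zζ)/exp_q(qωζ) dζ dω`;
the direction of the ray is allowed to vary with `ω`. -/
def qCauchyIntegral (q : ℝ) (f : ℂ → ℂ) (ε : ℝ) (k : ℕ) (θ : ℂ → ℝ) (z : ℂ) : ℂ :=
  ((q - 1 : ℝ) : ℂ) / (2 * Real.pi * Complex.I * Real.log q) *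
    ∮ ω in C(0, ε), f ω * rayIntegral (θ ω) (qKernel q k z ω)

end

/-!
On `(0, ∞)` the quotient `E(s) = exp_q(zs) / exp_q(ws)` satisfies
`E(s) - E(qs) = (q - 1) (w - z) s · exp_q(zs) / exp_q(qws)`, so Frullani's formula evaluates the ray
integral for `k = 0` as `log q / (q - 1)` times the Cauchy kernel `1 / (w - z)`. Integrating the
`q`-difference equation of the kernel against `ds` turns the case `k` into the case `k + 1`, and
rotating the ray gives `log q / (q - 1) · [k]_q^! / ∏_{j ≤ k} (ω - q ^ j z)` in every admissible
direction. Up to the factor this is the `k`-th Jackson derivative in `z` of `1 / (ω - z)`, so the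
double integral is `D_q^k` applied to Cauchy's formula for `f`. At `z = 0` the Jackson derivatives
are read off the Maclaurin series, on which `D_q` acts as the moment derivative.
-/

open Asymptotics Complex Filter MeasureTheory Set Topology

section QNumbers

variable {q : ℝ}

theorem natCast_le_qNumber (hq : 1 ≤ q) (n : ℕ) : (n : ℝ) ≤ qNumber q n := by
  simpa [qNumber] using Finset.card_nsmul_le_sum (Finset.range n) (fun j => q ^ j) 1
    fun j _ => one_le_pow₀ hq

theorem qNumber_succ_pos (hq : 1 ≤ q) (n : ℕ) : 0 < qNumber q (n + 1) :=
  lt_of_lt_of_le (by positivity) (natCast_le_qNumber hq (n + 1))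

theorem ofReal_sub_one_mul_qNumber (q : ℝ) (n : ℕ) :
    ((q : ℂ) - 1) * (qNumber q n : ℂ) = (q : ℂ) ^ n - 1 := by
  exact_mod_cast congrArg ((↑) : ℝ → ℂ) (mul_geom_sum q n)

theorem qFactorial_zero (q : ℝ) : qFactorial q 0 = 1 := Finset.prod_range_zero _

theorem qFactorial_succ (q : ℝ) (n : ℕ) :
    qFactorial q (n + 1) = qFactorial q n * qNumber q (n + 1) :=
  Finset.prod_range_succ _ _

theorem qFactorial_pos (hq : 1 ≤ q) (n : ℕ) : 0 < qFactorial q n :=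
  Finset.prod_pos fun j _ => qNumber_succ_pos hq j

theorem factorial_le_qFactorial (hq : 1 ≤ q) (n : ℕ) : (n.factorial : ℝ) ≤ qFactorial q n := by
  rw [qFactorial, ← Finset.prod_range_add_one_eq_factorial, Nat.cast_prod]
  exact Finset.prod_le_prod (fun _ _ => Nat.cast_nonneg _) fun j _ => natCast_le_qNumber hq (j + 1)

end QNumbers

theorem ofReal_mul_mem_slitPlane {r : ℝ} (hr : 0 < r) {z : ℂ} (hz : z ∈ slitPlane) :
    r * z ∈ slitPlane := by
  simpa [mem_slitPlane_iff, hr, hr.ne'] using hz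

theorem one_add_ne_zero_of_mem_slitPlane {z : ℂ} (hz : z ∈ slitPlane) : 1 + z ≠ 0 := by
  intro h
  rw [← neg_eq_of_add_eq_zero_right h] at hz
  norm_num [mem_slitPlane_iff] at hz

section QExp

variable {q : ℝ} {z w : ℂ}

theorem norm_pow_div_qFactorial_le (hq : 1 ≤ q) (n : ℕ) {R : ℝ} (hz : ‖z‖ ≤ R) :
    ‖z ^ n / (qFactorial q n : ℂ)‖ ≤ R ^ n / n.factorial := by
  have hR : 0 ≤ R := (norm_nonneg z).trans hz
  rw [norm_div, norm_pow, norm_real, Real.norm_of_nonneg (qFactorial_pos hq n).le]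
  gcongr
  exact factorial_le_qFactorial hq n

theorem hasSum_qExp (hq : 1 ≤ q) (z : ℂ) :
    HasSum (fun n : ℕ => z ^ n / (qFactorial q n : ℂ)) (qExp q z) :=
  (Summable.of_norm_bounded (Real.summable_pow_div_factorial ‖z‖)
    fun n => norm_pow_div_qFactorial_le hq n le_rfl).hasSum

theorem continuous_qExp (hq : 1 ≤ q) : Continuous (qExp q) := by
  refine continuous_iff_continuousAt.mpr fun z => ?_
  have hcont : ContinuousOn (qExp q) {x | ‖x‖ < ‖z‖ + 1} :=
    continuousOn_tsum (fun n => by fun_prop) (Real.summable_pow_div_factorial (‖z‖ + 1))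
      fun n x hx => norm_pow_div_qFactorial_le hq n (le_of_lt hx)
  exact hcont.continuousAt ((isOpen_lt continuous_norm continuous_const).mem_nhds (by simp))

theorem qExp_zero (q : ℝ) : qExp q 0 = 1 := by
  rw [qExp, tsum_eq_single 0 fun n hn => by rw [zero_pow hn, zero_div]]
  simp [qFactorial_zero]

theorem qExp_mul (hq : 1 ≤ q) (z : ℂ) : qExp q (q * z) = (1 + (q - 1) * z) * qExp q z := by
  have hterm (n : ℕ) : (q * z) ^ (n + 1) / (qFactorial q (n + 1) : ℂ) -
      z ^ (n + 1) / (qFactorial q (n + 1) : ℂ) = (q - 1) * z * (z ^ n / (qFactorial q n : ℂ)) := by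
    have hfac : (qFactorial q n : ℂ) ≠ 0 := mod_cast (qFactorial_pos hq n).ne'
    have hnum : (qNumber q (n + 1) : ℂ) ≠ 0 := mod_cast (qNumber_succ_pos hq n).ne'
    rw [qFactorial_succ, ofReal_mul, mul_pow]
    field_simp
    linear_combination (-z ^ (n + 1)) * ofReal_sub_one_mul_qNumber q (n + 1)
  have hdiff := (hasSum_nat_add_iff' 1).mpr ((hasSum_qExp hq (q * z)).sub (hasSum_qExp hq z))
  simp only [hterm, Finset.sum_range_one, pow_zero, sub_self, sub_zero] at hdiff
  linear_combination hdiff.unique ((hasSum_qExp hq z).mul_left ((q - 1) * z))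

theorem qExp_pow_mul (hq : 1 ≤ q) (z : ℂ) (n : ℕ) :
    qExp q (q ^ n * z) = (∏ j ∈ Finset.range n, (1 + (q - 1) * (q ^ j * z))) * qExp q z := by
  induction n with
  | zero => simp
  | succ n ih => rw [Finset.prod_range_succ, pow_succ', mul_assoc, qExp_mul hq, ih]; ring

-- Write `z = qⁿ x` with `x` so small that `exp_q(x) ≠ 0`; no factor of `qExp_pow_mul` vanishes.
theorem qExp_ne_zero (hq : 1 < q) (hz : z ∈ slitPlane) : qExp q z ≠ 0 := by
  have hq0 : 0 < q := one_pos.trans hq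
  have hlim : Tendsto (fun n : ℕ => ((q⁻¹ ^ n : ℝ) : ℂ) * z) atTop (𝓝 0) := by
    have hpow := tendsto_pow_atTop_nhds_zero_of_lt_one (inv_nonneg.mpr hq0.le)
      (inv_lt_one_of_one_lt₀ hq)
    simpa using hpow.ofReal.mul_const z
  have hnear : ∀ᶠ x in 𝓝 (0 : ℂ), qExp q x ≠ 0 :=
    (continuous_qExp hq.le).continuousAt.eventually_ne (by simp [qExp_zero])
  obtain ⟨n, hn⟩ := (hlim.eventually hnear).exists
  have hz_eq : z = (q : ℂ) ^ n * (((q⁻¹ ^ n : ℝ) : ℂ) * z) := by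
    have : (q : ℂ) ≠ 0 := mod_cast hq0.ne'
    rw [← mul_assoc, ofReal_pow, ofReal_inv, ← mul_pow, mul_inv_cancel₀ this, one_pow, one_mul]
  rw [hz_eq, qExp_pow_mul hq.le]
  refine mul_ne_zero (Finset.prod_ne_zero_iff.mpr fun j _ => ?_) hn
  have hpos : 0 < (q - 1) * (q ^ j * q⁻¹ ^ n) := mul_pos (sub_pos.mpr hq) (by positivity)
  simpa [mul_assoc] using one_add_ne_zero_of_mem_slitPlane (ofReal_mul_mem_slitPlane hpos hz)

/-- The quotient `exp_q(zζ) / exp_q(wζ)`, to which Frullani's formula is applied on `(0, ∞)`;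
`qKernel q k z ω ζ` is `ζ ^ k` times its instance `w = qω`. -/
noncomputable def qExpQuotient (q : ℝ) (z w ζ : ℂ) : ℂ := qExp q (z * ζ) / qExp q (w * ζ)

theorem qExpQuotient_mul (hq : 1 ≤ q) (z w ζ : ℂ) :
    qExpQuotient q z w (q * ζ) =
      (1 + (q - 1) * (z * ζ)) / (1 + (q - 1) * (w * ζ)) * qExpQuotient q z w ζ := by
  rw [qExpQuotient, qExpQuotient, mul_left_comm z, mul_left_comm w, qExp_mul hq, qExp_mul hq,
    mul_div_mul_comm]

theorem qExp_mul_ofReal_ne_zero (hq : 1 < q) (hw : w ∈ slitPlane) {s : ℝ} (hs : 0 ≤ s) :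
    qExp q (w * s) ≠ 0 := by
  rcases hs.eq_or_lt with rfl | hs
  · simp [qExp_zero]
  · rw [mul_comm]
    exact qExp_ne_zero hq (ofReal_mul_mem_slitPlane hs hw)

theorem continuousOn_qExpQuotient (hq : 1 < q) (z : ℂ) (hw : w ∈ slitPlane) :
    ContinuousOn (fun s : ℝ => qExpQuotient q z w s) (Ici 0) := by
  have hexp := continuous_qExp hq.le
  exact ContinuousOn.div (hexp.comp (by fun_prop)).continuousOn
    (hexp.comp (by fun_prop)).continuousOn fun s hs => qExp_mul_ofReal_ne_zero hq hw hs

end QExp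

section Growth

variable {q : ℝ}

theorem exists_pow_mul_eq_of_le (hq : 1 < q) {S t : ℝ} (hS : 0 < S) (ht : S ≤ t) :
    ∃ n : ℕ, ∃ s ∈ Icc S (q * S), q ^ n * s = t := by
  obtain ⟨n, hn, hn'⟩ := exists_nat_pow_near ((one_le_div hS).mpr ht) hq
  have hqn : 0 < q ^ n := pow_pos (one_pos.trans hq) n
  rw [le_div_iff₀ hS] at hn
  rw [div_lt_iff₀ hS, pow_succ, mul_assoc] at hn'
  exact ⟨n, t / q ^ n, ⟨(le_div_iff₀' hqn).mpr hn, (div_le_iff₀' hqn).mpr hn'.le⟩,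
    mul_div_cancel₀ _ hqn.ne'⟩

-- The inequality propagates a bound for `‖g s‖ / s ^ a` from `[S, qS]` to all `qⁿ [S, qS]`.
theorem isBigO_rpow_of_norm_comp_mul_le {E : Type*} [NormedAddCommGroup E] {g : ℝ → E} {a : ℝ}
    (hq : 1 < q) (hg : ContinuousOn g (Ici 0))
    (h : ∀ᶠ s in atTop, ‖g (q * s)‖ ≤ q ^ a * ‖g s‖) : g =O[atTop] fun s : ℝ => s ^ a := by
  have hq0 : 0 < q := one_pos.trans hq
  obtain ⟨S, hS⟩ := eventually_atTop.mp (h.and (eventually_gt_atTop 0))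
  have hS0 : 0 < S := (hS S le_rfl).2
  have hiter (n : ℕ) {s : ℝ} (hs : S ≤ s) : ‖g (q ^ n * s)‖ ≤ (q ^ n) ^ a * ‖g s‖ := by
    induction n with
    | zero => simp
    | succ n ih =>
      have hle : S ≤ q ^ n * s :=
        hs.trans (le_mul_of_one_le_left (hS0.le.trans hs) (one_le_pow₀ hq.le))
      calc ‖g (q ^ (n + 1) * s)‖ = ‖g (q * (q ^ n * s))‖ := by rw [pow_succ', mul_assoc]
        _ ≤ q ^ a * ‖g (q ^ n * s)‖ := (hS _ hle).1
        _ ≤ q ^ a * ((q ^ n) ^ a * ‖g s‖) := by gcongr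
        _ = (q ^ (n + 1)) ^ a * ‖g s‖ := by
          rw [pow_succ', Real.mul_rpow hq0.le (by positivity), mul_assoc]
  have hcont : ContinuousOn (fun s => ‖g s‖ / s ^ a) (Icc S (q * S)) :=
    ((hg.mono fun s hs => hS0.le.trans hs.1).norm).div
      (continuousOn_id.rpow_const fun s hs => Or.inl (hS0.trans_le hs.1).ne')
      fun s hs => (Real.rpow_pos_of_pos (hS0.trans_le hs.1) a).ne'
  obtain ⟨C, hC⟩ := isCompact_Icc.bddAbove_image hcont
  refine IsBigO.of_bound C ((eventually_ge_atTop S).mono fun t ht => ?_)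
  obtain ⟨n, s, hs, rfl⟩ := exists_pow_mul_eq_of_le hq hS0 ht
  have hs0 : 0 < s := hS0.trans_le hs.1
  calc ‖g (q ^ n * s)‖ ≤ (q ^ n) ^ a * ‖g s‖ := hiter n hs.1
    _ ≤ (q ^ n) ^ a * (C * s ^ a) := by
      gcongr
      exact (div_le_iff₀ (Real.rpow_pos_of_pos hs0 a)).mp (hC (mem_image_of_mem _ hs))
    _ = C * ‖(q ^ n * s) ^ a‖ := by
      rw [Real.norm_of_nonneg (by positivity), Real.mul_rpow (by positivity) hs0.le]
      ring

theorem tendsto_one_add_mul_div_one_add_mul_atTop (b : ℂ) {c : ℂ} (hc : c ≠ 0) :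
    Tendsto (fun s : ℝ => (1 + b * s) / (1 + c * s)) atTop (𝓝 (b / c)) := by
  have hinv : Tendsto (fun s : ℝ => (s : ℂ)⁻¹) atTop (𝓝 0) := by
    simpa using (tendsto_inv_atTop_zero (𝕜 := ℝ)).ofReal
  have hlim := (hinv.add_const b).div (hinv.add_const c) (by simpa using hc)
  simp only [zero_add] at hlim
  refine hlim.congr' ((eventually_ne_atTop 0).mono fun s hs => ?_)
  have hs' : (s : ℂ) ≠ 0 := mod_cast hs
  rw [Pi.div_apply, ← mul_div_mul_right _ _ hs', add_mul, add_mul, inv_mul_cancel₀ hs']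

theorem isBigO_qExpQuotient_rpow (hq : 1 < q) {z w : ℂ} (hw : w ∈ slitPlane) {a : ℝ}
    (h : ‖z‖ < q ^ a * ‖w‖) : (fun s : ℝ => qExpQuotient q z w s) =O[atTop] fun s : ℝ => s ^ a := by
  have hw0 : w ≠ 0 := slitPlane_ne_zero hw
  have hq1 : (q : ℂ) - 1 ≠ 0 := sub_ne_zero.mpr (mod_cast hq.ne')
  refine isBigO_rpow_of_norm_comp_mul_le hq (continuousOn_qExpQuotient hq z hw) ?_
  have hlim := (tendsto_one_add_mul_div_one_add_mul_atTop ((q - 1) * z) (mul_ne_zero hq1 hw0)).norm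
  rw [mul_div_mul_left _ _ hq1, norm_div] at hlim
  have hlt : ‖z‖ / ‖w‖ < q ^ a := (div_lt_iff₀ (norm_pos_iff.mpr hw0)).mpr h
  filter_upwards [hlim.eventually_lt_const hlt] with s hs
  rw [ofReal_mul, qExpQuotient_mul hq.le, norm_mul, ← mul_assoc, ← mul_assoc]
  gcongr

theorem exists_lt_rpow_mul (hq : 0 < q) {x y b : ℝ} (h : x < q ^ b * y) :
    ∃ a < b, x < q ^ a * y := by
  have hcont : ContinuousAt (fun a : ℝ => q ^ a * y) b :=
    (Real.continuousAt_const_rpow hq.ne').mul continuousAt_const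
  exact (((hcont.eventually_const_lt h).filter_mono nhdsWithin_le_nhds).and
    (self_mem_nhdsWithin (s := Iio b))).exists.imp fun _ ha => ha.symm

theorem tendsto_qExpQuotient_atTop (hq : 1 < q) {z w : ℂ} (hw : w ∈ slitPlane) (h : ‖z‖ < ‖w‖) :
    Tendsto (fun s : ℝ => qExpQuotient q z w s) atTop (𝓝 0) := by
  obtain ⟨a, ha, hlt⟩ := exists_lt_rpow_mul (x := ‖z‖) (y := ‖w‖) (b := 0) (one_pos.trans hq)
    (by simpa using h)
  refine (isBigO_qExpQuotient_rpow hq hw hlt).trans_tendsto ?_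
  simpa using tendsto_rpow_neg_atTop (neg_pos.mpr ha)

theorem continuousOn_qKernel (hq : 1 < q) (k : ℕ) (z : ℂ) {w : ℂ} (hw : w ∈ slitPlane) :
    ContinuousOn (fun s : ℝ => qKernel q k z w s) (Ici 0) :=
  (continuous_ofReal.pow k).continuousOn.mul
    (continuousOn_qExpQuotient hq z (ofReal_mul_mem_slitPlane (one_pos.trans hq) hw))

theorem integrableOn_qKernel (hq : 1 < q) (k : ℕ) {z w : ℂ} (hw : w ∈ slitPlane)
    (hzw : q ^ k * ‖z‖ < ‖w‖) : IntegrableOn (fun s : ℝ => qKernel q k z w s) (Ioi 0) := by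
  have hq0 : 0 < q := one_pos.trans hq
  have hlt : ‖z‖ < q ^ (-(k + 1 : ℝ)) * ‖(q : ℂ) * w‖ := by
    rw [Real.rpow_neg hq0.le, norm_mul, norm_real, Real.norm_of_nonneg hq0.le, lt_inv_mul_iff₀
      (by positivity), ← Nat.cast_add_one, Real.rpow_natCast, pow_succ', mul_assoc]
    gcongr
  obtain ⟨a, ha, hlt⟩ := exists_lt_rpow_mul hq0 hlt
  have hpow : (fun s : ℝ => (s : ℂ) ^ k) =O[atTop] fun s : ℝ => s ^ (k : ℝ) :=
    IsBigO.of_bound 1 (Eventually.of_forall fun s => by simp)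
  have hO : (fun s : ℝ => qKernel q k z w s) =O[atTop] fun s : ℝ => s ^ (k + a) := by
    refine (hpow.mul (isBigO_qExpQuotient_rpow hq (ofReal_mul_mem_slitPlane hq0 hw) hlt)).congr'
      EventuallyEq.rfl ((eventually_gt_atTop 0).mono fun s hs => ?_)
    exact (Real.rpow_add hs _ _).symm
  have hloc : LocallyIntegrableOn (fun s : ℝ => qKernel q k z w s) (Ici 0) :=
    (continuousOn_qKernel hq k z hw).locallyIntegrableOn measurableSet_Ici
  exact (hloc.integrableOn_of_isBigO_atTop hO
    (integrableAtFilter_rpow_atTop_iff.mpr (by linarith))).mono_set Ioi_subset_Ici_self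

end Growth

section CauchyKernel

variable {q : ℝ} {k : ℕ} {z w : ℂ}

/-- The kernel `[k]_q^! / ∏_{j ≤ k} (w - q ^ j z)`, i.e. the `k`-th Jackson derivative in `z` of the
Cauchy kernel `1 / (w - z)`. -/
noncomputable def qCauchyKernel (q : ℝ) (k : ℕ) (z w : ℂ) : ℂ :=
  qFactorial q k / ∏ j ∈ Finset.range (k + 1), (w - q ^ j * z)

theorem qCauchyKernel_zero (q : ℝ) (z w : ℂ) : qCauchyKernel q 0 z w = (w - z)⁻¹ := by
  simp [qCauchyKernel, qFactorial_zero]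

theorem qCauchyKernel_succ (q : ℝ) (k : ℕ) (z w : ℂ) :
    qCauchyKernel q (k + 1) z w =
      qNumber q (k + 1) / (w - q ^ (k + 1) * z) * qCauchyKernel q k z w := by
  rw [qCauchyKernel, qCauchyKernel, qFactorial_succ, Finset.prod_range_succ, ofReal_mul,
    mul_div_mul_comm, mul_comm]

theorem qCauchyKernel_zero_left (q : ℝ) (k : ℕ) (w : ℂ) :
    qCauchyKernel q k 0 w = qFactorial q k / w ^ (k + 1) := by
  simp [qCauchyKernel]

theorem qCauchyKernel_mul_right (q : ℝ) (k : ℕ) (z w u : ℂ) :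
    qCauchyKernel q k (z * u) (w * u) = qCauchyKernel q k z w / u ^ (k + 1) := by
  simp only [qCauchyKernel, ← mul_assoc, ← sub_mul, Finset.prod_mul_distrib, Finset.prod_const,
    Finset.card_range, div_mul_eq_div_div]

theorem sub_pow_mul_ne_zero (hq : 1 ≤ q) (h : q ^ k * ‖z‖ < ‖w‖) {j : ℕ} (hj : j ≤ k) :
    w - q ^ j * z ≠ 0 := by
  refine fun heq => h.not_ge ?_
  have hq0 : 0 ≤ q := zero_le_one.trans hq
  rw [sub_eq_zero.mp heq, norm_mul, norm_pow, norm_real, Real.norm_of_nonneg hq0]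
  gcongr

theorem qCauchyKernel_mul_left (q : ℝ) (k : ℕ) (h : w ≠ z) :
    qCauchyKernel q k (q * z) w = (w - z) / (w - q ^ (k + 1) * z) * qCauchyKernel q k z w := by
  have hprod : (∏ j ∈ Finset.range (k + 1), (w - q ^ j * (q * z))) * (w - z) =
      (∏ j ∈ Finset.range (k + 1), (w - q ^ j * z)) * (w - q ^ (k + 1) * z) := by
    rw [← Finset.prod_range_succ (fun j => w - (q : ℂ) ^ j * z) (k + 1),
      Finset.prod_range_succ' _ (k + 1)]
    simp only [pow_zero, one_mul, pow_succ, mul_assoc]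
  rw [qCauchyKernel, qCauchyKernel, ← mul_div_mul_right _ _ (sub_ne_zero.mpr h), hprod,
    mul_comm (qFactorial q k : ℂ), mul_comm (Finset.prod _ _), mul_div_mul_comm]

theorem jacksonDeriv_qCauchyKernel (hq : 1 < q) (hz : z ≠ 0) (h : q ^ (k + 1) * ‖z‖ < ‖w‖) :
    jacksonDeriv q (fun x => qCauchyKernel q k x w) z = qCauchyKernel q (k + 1) z w := by
  have hwz : w ≠ z := by simpa [sub_ne_zero] using sub_pow_mul_ne_zero hq.le h (Nat.zero_le _)
  have hwqz := sub_pow_mul_ne_zero hq.le h le_rfl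
  have hqz : (q : ℂ) * z - z ≠ 0 := by
    rw [← sub_one_mul]
    exact mul_ne_zero (sub_ne_zero.mpr (mod_cast hq.ne')) hz
  rw [jacksonDeriv, if_neg hz, qCauchyKernel_mul_left q k hwz, qCauchyKernel_succ, div_eq_iff hqz]
  generalize hd : w - (q : ℂ) ^ (k + 1) * z = d at hwqz ⊢
  field_simp
  rw [← hd]
  linear_combination (-z * qCauchyKernel q k z w) * ofReal_sub_one_mul_qNumber q (k + 1)

theorem continuousOn_qCauchyKernel (hq : 1 ≤ q) {ε : ℝ} (h : q ^ k * ‖z‖ < ε) :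
    ContinuousOn (qCauchyKernel q k z) (Metric.sphere 0 ε) := by
  refine continuousOn_const.div (by fun_prop) fun w hw => Finset.prod_ne_zero_iff.mpr fun j hj => ?_
  rw [← mem_sphere_zero_iff_norm.mp hw] at h
  exact sub_pow_mul_ne_zero hq h (Finset.mem_range_succ_iff.mp hj)

end CauchyKernel

section RayIntegral

variable {q : ℝ} {k : ℕ} {z w ω : ℂ} {θ : ℝ}

theorem qExpQuotient_sub_qExpQuotient_mul (hq : 1 < q) (hw : w ∈ slitPlane) {s : ℝ} (hs : 0 < s) :
    qExpQuotient q z w s - qExpQuotient q z w (q * s) =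
      (q - 1) * (w - z) * (s * qKernel q 0 z w s) := by
  have hden : 1 + ((q : ℂ) - 1) * (w * s) ≠ 0 := by
    have hmem := ofReal_mul_mem_slitPlane (mul_pos (sub_pos.mpr hq) hs) hw
    simpa [mul_assoc, mul_comm w] using one_add_ne_zero_of_mem_slitPlane hmem
  rw [qExpQuotient_mul hq.le, qKernel, qExpQuotient, mul_assoc (q : ℂ), qExp_mul hq.le]
  generalize hd : 1 + ((q : ℂ) - 1) * (w * s) = d at hden ⊢
  field_simp
  rw [← hd]
  ring

theorem integral_qKernel_zero (hq : 1 < q) (hw : w ∈ slitPlane) (h : ‖z‖ < ‖w‖) :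
    ∫ s : ℝ in Ioi 0, qKernel q 0 z w s = Real.log q / (q - 1) * (w - z)⁻¹ := by
  have hq1 : (q : ℂ) - 1 ≠ 0 := sub_ne_zero.mpr (mod_cast hq.ne')
  have hwz : w - z ≠ 0 := sub_ne_zero.mpr fun heq => h.ne' (congrArg norm heq)
  have hcont := continuousOn_qExpQuotient hq z hw
  have hdiff : EqOn (fun s : ℝ => s⁻¹ • (qExpQuotient q z w ((1 * s : ℝ) : ℂ) -
      qExpQuotient q z w ((q * s : ℝ) : ℂ))) (fun s => (q - 1) * (w - z) * qKernel q 0 z w s)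
      (Ioi 0) := fun s hs => by
    have hs0 : (s : ℂ) ≠ 0 := mod_cast (ne_of_gt hs)
    simp only [one_mul, ofReal_mul, qExpQuotient_sub_qExpQuotient_mul hq hw hs, real_smul,
      ofReal_inv]
    field_simp
  have hzero : Tendsto (fun s : ℝ => qExpQuotient q z w s) (𝓝[>] 0) (𝓝 1) := by
    simpa [ContinuousWithinAt, qExpQuotient, qExp_zero] using
      (hcont 0 self_mem_Ici).mono Ioi_subset_Ici_self
  have hint : IntegrableOn (fun s : ℝ => qKernel q 0 z w s) (Ioi 0) :=
    integrableOn_qKernel hq 0 hw (by simpa using h)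
  have hfrullani := Frullani.integral_Ioi_eq
    ((hcont.mono Ioi_subset_Ici_self).locallyIntegrableOn measurableSet_Ioi) one_pos
    (one_pos.trans hq) hzero (tendsto_qExpQuotient_atTop hq hw h)
    ((integrableOn_congr_fun hdiff measurableSet_Ioi).mpr (hint.const_mul _))
  rw [setIntegral_congr_fun measurableSet_Ioi hdiff, integral_const_mul] at hfrullani
  simp only [div_one, sub_zero, real_smul, mul_one] at hfrullani
  field_simp
  linear_combination hfrullani

theorem qKernel_mul_add (hq : 1 < q) (k : ℕ) (z : ℂ) (hw : w ∈ slitPlane) {s : ℝ} (hs : 0 < s) :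
    qKernel q k z w ↑(q * s) + (q - 1) * w * qKernel q (k + 1) z w ↑(q * s) =
      q ^ k * (qKernel q k z w s + (q - 1) * z * qKernel q (k + 1) z w s) := by
  have hden : 1 + ((q : ℂ) - 1) * (q * w * s) ≠ 0 := by
    have hpos : 0 < (q - 1) * (q * s) := mul_pos (sub_pos.mpr hq) (mul_pos (one_pos.trans hq) hs)
    have hmem := ofReal_mul_mem_slitPlane hpos hw
    simpa [mul_assoc, mul_comm w] using one_add_ne_zero_of_mem_slitPlane hmem
  have hquot : (1 + ((q : ℂ) - 1) * (q * w * s)) * qExpQuotient q z (q * w) (q * s) =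
      (1 + (q - 1) * (z * s)) * qExpQuotient q z (q * w) s := by
    rw [qExpQuotient_mul hq.le, ← mul_assoc, mul_div_cancel₀ _ hden]
  simp only [qExpQuotient] at hquot
  simp only [qKernel, ofReal_mul, mul_pow, pow_succ]
  linear_combination (q : ℂ) ^ k * (s : ℂ) ^ k * hquot

theorem integral_qKernel_succ (hq : 1 < q) (hw : w ∈ slitPlane) (h : q ^ (k + 1) * ‖z‖ < ‖w‖) :
    ∫ s : ℝ in Ioi 0, qKernel q (k + 1) z w s =
      qNumber q (k + 1) / (w - q ^ (k + 1) * z) * ∫ s : ℝ in Ioi 0, qKernel q k z w s := by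
  have hq0 : 0 < q := one_pos.trans hq
  have hq1 : (q : ℂ) - 1 ≠ 0 := sub_ne_zero.mpr (mod_cast hq.ne')
  have hwz := sub_pow_mul_ne_zero hq.le h le_rfl
  have hk : IntegrableOn (fun s : ℝ => qKernel q k z w s) (Ioi 0) :=
    integrableOn_qKernel hq k hw (h.trans_le' (by gcongr; exacts [hq.le, k.le_succ]))
  have hk1 := integrableOn_qKernel hq (k + 1) hw h
  have hscale := integral_comp_mul_left_Ioi
    (fun s : ℝ => qKernel q k z w s + (q - 1) * w * qKernel q (k + 1) z w s) 0 hq0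
  rw [setIntegral_congr_fun measurableSet_Ioi fun s hs => qKernel_mul_add hq k z hw hs, mul_zero,
    integral_const_mul, integral_add hk (hk1.const_mul _), integral_add hk (hk1.const_mul _),
    integral_const_mul, integral_const_mul, real_smul, ofReal_inv,
    eq_inv_mul_iff_mul_eq₀ (mod_cast hq0.ne')] at hscale
  rw [div_mul_eq_mul_div, eq_div_iff hwz]
  refine mul_left_cancel₀ hq1 ?_
  linear_combination -hscale -
    (∫ s : ℝ in Ioi 0, qKernel q k z w s) * ofReal_sub_one_mul_qNumber q (k + 1)

theorem integral_qKernel (hq : 1 < q) (hw : w ∈ slitPlane) (h : q ^ k * ‖z‖ < ‖w‖) :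
    ∫ s : ℝ in Ioi 0, qKernel q k z w s = Real.log q / (q - 1) * qCauchyKernel q k z w := by
  induction k with
  | zero => rw [integral_qKernel_zero hq hw (by simpa using h), qCauchyKernel_zero]
  | succ k ih =>
    rw [integral_qKernel_succ hq hw h, qCauchyKernel_succ,
      ih (h.trans_le' (by gcongr; exacts [hq.le, k.le_succ]))]
    ring

theorem mul_exp_mem_slitPlane (hω : ω ≠ 0) (h : Admissible ω θ) : ω * exp (θ * I) ∈ slitPlane := by
  rw [mem_slitPlane_iff_arg]
  refine ⟨fun harg => h ?_, mul_ne_zero hω (exp_ne_zero _)⟩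
  rw [← harg, arg_mul_coe_angle hω (exp_ne_zero _), Real.Angle.coe_add, arg_exp_mul_I,
    Real.Angle.coe_toIocMod]

theorem qKernel_mul_right (q : ℝ) (k : ℕ) (z ω ζ u : ℂ) :
    qKernel q k z ω (ζ * u) = u ^ k * qKernel q k (z * u) (ω * u) ζ := by
  have hnum : z * (ζ * u) = z * u * ζ := by ring
  have hden : q * ω * (ζ * u) = q * (ω * u) * ζ := by ring
  rw [qKernel, qKernel, hnum, hden]
  ring

theorem rayIntegrable_qKernel (hq : 1 < q) (hzω : q ^ k * ‖z‖ < ‖ω‖) (h : Admissible ω θ) :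
    RayIntegrable θ (qKernel q k z ω) := by
  have hω : ω ≠ 0 := norm_pos_iff.mp (hzω.trans_le' (by positivity))
  simp only [RayIntegrable, qKernel_mul_right]
  exact (integrableOn_qKernel hq k (mul_exp_mem_slitPlane hω h)
    (by simpa [norm_exp_ofReal_mul_I] using hzω)).const_mul _

theorem rayIntegral_qKernel (hq : 1 < q) (hzω : q ^ k * ‖z‖ < ‖ω‖) (h : Admissible ω θ) :
    rayIntegral θ (qKernel q k z ω) = Real.log q / (q - 1) * qCauchyKernel q k z ω := by
  have hω : ω ≠ 0 := norm_pos_iff.mp (hzω.trans_le' (by positivity))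
  simp only [rayIntegral, qKernel_mul_right]
  rw [integral_mul_const, integral_const_mul, integral_qKernel hq (mul_exp_mem_slitPlane hω h)
    (by simpa [norm_exp_ofReal_mul_I] using hzω), qCauchyKernel_mul_right, pow_succ]
  have hu := exp_ne_zero (θ * I)
  field_simp

end RayIntegral

section PowerSeries

variable {q R : ℝ} {a : PowerSeries ℂ} {g : ℂ → ℂ}

/-- The power series `a` converges to `g` on the open disc of radius `R` about the origin. -/
def HasSumOnDisc (a : PowerSeries ℂ) (g : ℂ → ℂ) (R : ℝ) : Prop :=
  ∀ z : ℂ, ‖z‖ < R → HasSum (fun n : ℕ => PowerSeries.coeff n a * z ^ n) (g z)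

theorem hasSumOnDisc_maclaurin {f : ℂ → ℂ} (hf : DifferentiableOn ℂ f (Metric.ball 0 R)) :
    HasSumOnDisc (maclaurin f) f R := by
  refine fun z hz => (hasSum_taylorSeries_on_ball hf (mem_ball_zero_iff.mpr hz)).congr_fun
    fun n => ?_
  simp only [maclaurin, PowerSeries.coeff_mk, sub_zero, smul_eq_mul]
  ring

theorem coeff_iterate_momentDeriv {m : ℕ → ℝ} (hm : ∀ n, m n ≠ 0) (a : PowerSeries ℂ) (k n : ℕ) :
    PowerSeries.coeff n ((momentDeriv m)^[k] a) =
      (m (n + k) / m n : ℂ) * PowerSeries.coeff (n + k) a := by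
  have hm' (n : ℕ) : (m n : ℂ) ≠ 0 := mod_cast hm n
  induction k generalizing n with
  | zero => simp [hm' n]
  | succ k ih =>
    rw [Function.iterate_succ_apply', momentDeriv, PowerSeries.coeff_mk, ih, ofReal_div,
      add_right_comm n 1 k, ← mul_assoc, mul_comm ((m (n + 1) : ℂ) / _),
      div_mul_div_cancel₀ (hm' (n + 1)), add_assoc]

namespace HasSumOnDisc

theorem apply_zero (h : HasSumOnDisc a g R) (hR : 0 < R) : g 0 = PowerSeries.coeff 0 a := by
  refine (h 0 (by simpa using hR)).unique ?_
  simpa using hasSum_single (f := fun n : ℕ => PowerSeries.coeff n a * (0 : ℂ) ^ n) 0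
    fun n hn => by rw [zero_pow hn, mul_zero]

theorem deriv_zero (h : HasSumOnDisc a g R) (hR : 0 < R) :
    deriv g 0 = PowerSeries.coeff 1 a := by
  have hp : HasFPowerSeriesAt g (.ofScalars ℂ fun n => PowerSeries.coeff n a) 0 := by
    rw [hasFPowerSeriesAt_iff]
    filter_upwards [Metric.ball_mem_nhds (0 : ℂ) hR] with x hx
    simpa [mul_comm] using h x (by simpa using hx)
  simpa [FormalMultilinearSeries.ofScalars] using hp.deriv

theorem map_jacksonDeriv (h : HasSumOnDisc a g R) (hq : 1 < q) :
    HasSumOnDisc (momentDeriv (qFactorial q) a) (jacksonDeriv q g) (R / q) := by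
  intro z hz
  have hq0 : 0 < q := one_pos.trans hq
  have hcoeff (n : ℕ) : PowerSeries.coeff n (momentDeriv (qFactorial q) a) =
      qNumber q (n + 1) * PowerSeries.coeff (n + 1) a := by
    rw [momentDeriv, PowerSeries.coeff_mk, qFactorial_succ,
      mul_div_cancel_left₀ _ (qFactorial_pos hq.le n).ne']
  simp only [hcoeff]
  rw [lt_div_iff₀' hq0] at hz
  rcases eq_or_ne z 0 with rfl | hz0
  · rw [jacksonDeriv, if_pos rfl, h.deriv_zero (by simpa using hz)]
    simpa [qNumber] using hasSum_single (f := fun n : ℕ =>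
      (qNumber q (n + 1) : ℂ) * PowerSeries.coeff (n + 1) a * (0 : ℂ) ^ n) 0
      fun n hn => by rw [zero_pow hn, mul_zero]
  · have hqz : (q : ℂ) * z - z ≠ 0 := by
      rw [← sub_one_mul]
      exact mul_ne_zero (sub_ne_zero.mpr (mod_cast hq.ne')) hz0
    have hdiff := (h (q * z) (by simpa [abs_of_pos hq0] using hz)).sub
      (h z (hz.trans_le' (le_mul_of_one_le_left (norm_nonneg z) hq.le)))
    rw [← hasSum_nat_add_iff' 1] at hdiff
    simp only [Finset.range_one, Finset.sum_singleton, pow_zero, sub_self, sub_zero] at hdiff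
    rw [jacksonDeriv, if_neg hz0]
    refine (hdiff.div_const (q * z - z)).congr_fun fun n => ?_
    rw [eq_div_iff hqz, mul_pow]
    linear_combination (PowerSeries.coeff (n + 1) a * z ^ (n + 1)) *
      ofReal_sub_one_mul_qNumber q (n + 1)

theorem iterate_jacksonDeriv (h : HasSumOnDisc a g R) (hq : 1 < q) (k : ℕ) :
    HasSumOnDisc ((momentDeriv (qFactorial q))^[k] a) ((jacksonDeriv q)^[k] g) (R / q ^ k) := by
  induction k with
  | zero => simpa using h
  | succ k ih =>
    rw [Function.iterate_succ_apply', Function.iterate_succ_apply', pow_succ, ← div_div]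
    exact ih.map_jacksonDeriv hq

end HasSumOnDisc

theorem iterate_jacksonDeriv_zero {f : ℂ → ℂ} (hq : 1 < q) (hR : 0 < R)
    (hf : DifferentiableOn ℂ f (Metric.ball 0 R)) (k : ℕ) :
    (jacksonDeriv q)^[k] f 0 = qFactorial q k * (iteratedDeriv k f 0 / k.factorial) := by
  have hsum := (hasSumOnDisc_maclaurin hf).iterate_jacksonDeriv hq k
  rw [hsum.apply_zero (div_pos hR (pow_pos (one_pos.trans hq) k)),
    coeff_iterate_momentDeriv fun n => (qFactorial_pos hq.le n).ne']
  simp [qFactorial_zero, maclaurin]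

end PowerSeries

theorem pqDeriv_one_left (q : ℝ) : pqDeriv 1 q = jacksonDeriv q := by
  funext f z
  simp only [pqDeriv, jacksonDeriv, ofReal_one, one_mul]
  rw [← neg_sub (f (q * z)), ← neg_sub (q * z), neg_div_neg_eq]

section CircleIntegral

variable {E : Type*} [NormedAddCommGroup E] {f g : ℂ → E} {c : ℂ} {R : ℝ}

theorem circleIntegrable_congr_ae (h : f ∘ circleMap c R =ᵐ[volume] g ∘ circleMap c R) :
    CircleIntegrable f c R ↔ CircleIntegrable g c R :=
  intervalIntegrable_congr_ae (ae_restrict_of_ae h)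

theorem circleIntegral_congr_ae [NormedSpace ℂ E]
    (h : f ∘ circleMap c R =ᵐ[volume] g ∘ circleMap c R) :
    ∮ ω in C(c, R), f ω = ∮ ω in C(c, R), g ω :=
  intervalIntegral.integral_congr_ae <|
    h.mono fun t ht _ => congrArg (deriv (circleMap c R) t • ·) ht

end CircleIntegral

section CauchyFormula

variable {q ε : ℝ} {f : ℂ → ℂ} {k : ℕ} {z : ℂ} {θ : ℂ → ℝ}

theorem circleIntegrable_mul_qCauchyKernel (hq : 1 < q)
    (hf : ContinuousOn f (Metric.sphere 0 ε)) (hz : q ^ k * ‖z‖ < ε) :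
    CircleIntegrable (fun ω => f ω * qCauchyKernel q k z ω) 0 ε :=
  (hf.mul (continuousOn_qCauchyKernel hq.le hz)).circleIntegrable
    (hz.le.trans' (by have := one_pos.trans hq; positivity))

theorem jacksonDeriv_circleIntegral (hq : 1 < q) (hf : ContinuousOn f (Metric.sphere 0 ε))
    (hz0 : z ≠ 0) (hz : q ^ (k + 1) * ‖z‖ < ε) :
    jacksonDeriv q (fun x => ∮ ω in C(0, ε), f ω * qCauchyKernel q k x ω) z =
      ∮ ω in C(0, ε), f ω * qCauchyKernel q (k + 1) z ω := by
  have hq0 : 0 < q := one_pos.trans hq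
  have hε : 0 < ε := hz.trans_le' (by positivity)
  have hint := circleIntegrable_mul_qCauchyKernel hq hf (k := k) (z := z)
    (hz.trans_le' (by gcongr; exacts [hq.le, k.le_succ]))
  have hint_mul := circleIntegrable_mul_qCauchyKernel hq hf (k := k) (z := q * z)
    (by rwa [norm_mul, norm_real, Real.norm_of_nonneg hq0.le, ← mul_assoc, ← pow_succ])
  rw [jacksonDeriv, if_neg hz0, ← circleIntegral.integral_sub hint_mul hint, div_eq_inv_mul,
    ← circleIntegral.integral_const_mul]
  refine circleIntegral.integral_congr hε.le fun ω hω => ?_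
  rw [← mem_sphere_zero_iff_norm.mp hω] at hz
  simp only [← jacksonDeriv_qCauchyKernel hq hz0 hz, jacksonDeriv, if_neg hz0]
  ring

theorem jacksonDeriv_const_mul (q : ℝ) (c : ℂ) (hz : z ≠ 0) :
    jacksonDeriv q (fun x => c * f x) z = c * jacksonDeriv q f z := by
  simp only [jacksonDeriv, if_neg hz]
  ring

theorem circleIntegral_mul_qCauchyKernel_zero_left (hq : 1 < q) (hε : 0 < ε)
    (hf : DiffContOnCl ℂ f (Metric.ball 0 ε)) (k : ℕ) :
    ∮ ω in C(0, ε), f ω * qCauchyKernel q k 0 ω =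
      2 * Real.pi * I * (jacksonDeriv q)^[k] f 0 := by
  have hcauchy := hf.circleIntegral_one_div_sub_center_pow_smul hε k
  simp only [sub_zero, smul_eq_mul] at hcauchy
  rw [iterate_jacksonDeriv_zero hq hε hf.differentiableOn, mul_div_assoc', mul_div_assoc']
  calc ∮ ω in C(0, ε), f ω * qCauchyKernel q k 0 ω
      = ∮ ω in C(0, ε), qFactorial q k * (1 / ω ^ (k + 1) * f ω) := by
        congr! 2 with ω
        rw [qCauchyKernel_zero_left]
        ring
    _ = _ := by
        rw [circleIntegral.integral_const_mul, hcauchy]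
        ring

theorem iterate_jacksonDeriv_eq_circleIntegral (hq : 1 < q)
    (hf : DiffContOnCl ℂ f (Metric.ball 0 ε)) (hz : q ^ k * ‖z‖ < ε) :
    (jacksonDeriv q)^[k] f z =
      (2 * Real.pi * I)⁻¹ * ∮ ω in C(0, ε), f ω * qCauchyKernel q k z ω := by
  have hq0 : 0 < q := one_pos.trans hq
  have hε : 0 < ε := hz.trans_le' (by positivity)
  rcases eq_or_ne z 0 with rfl | hz0
  · rw [circleIntegral_mul_qCauchyKernel_zero_left hq hε hf, inv_mul_cancel_left₀ two_pi_I_ne_zero]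
  induction k generalizing z with
  | zero =>
    have hcauchy := hf.two_pi_i_inv_smul_circleIntegral_sub_inv_smul
      (mem_ball_zero_iff.mpr (by simpa using hz))
    simpa [qCauchyKernel_zero, mul_comm] using hcauchy.symm
  | succ k ih =>
    have hqz0 : (q : ℂ) * z ≠ 0 := mul_ne_zero (mod_cast hq0.ne') hz0
    have hqz : q ^ k * ‖(q : ℂ) * z‖ < ε := by
      rwa [norm_mul, norm_real, Real.norm_of_nonneg hq0.le, ← mul_assoc, ← pow_succ]
    have hz' : q ^ k * ‖z‖ < ε := hz.trans_le' (by gcongr; exacts [hq.le, k.le_succ])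
    rw [Function.iterate_succ_apply', ← jacksonDeriv_circleIntegral hq
      (hf.continuousOn_ball.mono Metric.sphere_subset_closedBall) hz0 hz,
      ← jacksonDeriv_const_mul q _ hz0, jacksonDeriv, jacksonDeriv, if_neg hz0, if_neg hz0,
      ih hqz hqz0, ih hz' hz0]

theorem ae_admissible_of_countable (hε : 0 < ε)
    (h : {ω ∈ Metric.sphere (0 : ℂ) ε | ¬ Admissible ω (θ ω)}.Countable) :
    ∀ᵐ t : ℝ, Admissible (circleMap 0 ε t) (θ (circleMap 0 ε t)) := by
  filter_upwards [(h.preimage_circleMap 0 hε.ne').ae_notMem volume] with t ht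
  by_contra hadm
  exact ht ⟨circleMap_mem_sphere 0 hε.le t, hadm⟩

theorem mul_rayIntegral_qKernel_ae_eq (hq : 1 < q) (hz : q ^ k * ‖z‖ < ε) (f : ℂ → ℂ)
    (hθ : ∀ᵐ t : ℝ, Admissible (circleMap 0 ε t) (θ (circleMap 0 ε t))) :
    (fun ω => f ω * rayIntegral (θ ω) (qKernel q k z ω)) ∘ circleMap 0 ε =ᵐ[volume]
      (fun ω => Real.log q / (q - 1) * (f ω * qCauchyKernel q k z ω)) ∘ circleMap 0 ε := by
  filter_upwards [hθ] with t ht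
  have hzt : q ^ k * ‖z‖ < ‖circleMap 0 ε t‖ := by
    rw [norm_circleMap_zero]
    exact hz.trans_le (le_abs_self ε)
  rw [Function.comp_apply, Function.comp_apply, rayIntegral_qKernel hq hzt ht, mul_left_comm]

theorem circleIntegrable_mul_rayIntegral_qKernel (hq : 1 < q)
    (hf : ContinuousOn f (Metric.sphere 0 ε)) (hz : q ^ k * ‖z‖ < ε)
    (hθ : ∀ᵐ t : ℝ, Admissible (circleMap 0 ε t) (θ (circleMap 0 ε t))) :
    CircleIntegrable (fun ω => f ω * rayIntegral (θ ω) (qKernel q k z ω)) 0 ε :=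
  (circleIntegrable_congr_ae (mul_rayIntegral_qKernel_ae_eq hq hz f hθ)).mpr
    (circleIntegrable_mul_qCauchyKernel hq hf hz).const_smul

theorem qCauchyIntegral_eq_circleIntegral (hq : 1 < q) (hz : q ^ k * ‖z‖ < ε) (f : ℂ → ℂ)
    (hθ : ∀ᵐ t : ℝ, Admissible (circleMap 0 ε t) (θ (circleMap 0 ε t))) :
    qCauchyIntegral q f ε k θ z =
      (2 * Real.pi * I)⁻¹ * ∮ ω in C(0, ε), f ω * qCauchyKernel q k z ω := by
  have hq1 : (q : ℂ) - 1 ≠ 0 := sub_ne_zero.mpr (mod_cast hq.ne')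
  have hlog : (Real.log q : ℂ) ≠ 0 := mod_cast (Real.log_pos hq).ne'
  rw [qCauchyIntegral, circleIntegral_congr_ae (mul_rayIntegral_qKernel_ae_eq hq hz f hθ),
    circleIntegral.integral_const_mul, ofReal_sub, ofReal_one]
  field_simp

end CauchyFormula

theorem theorem2_general (q : ℝ) (hq : 1 < q) (f : ℂ → ℂ) (ε : ℝ)
    (hf : DiffContOnCl ℂ f (Metric.ball 0 ε)) (k : ℕ) (z : ℂ) (hz : ‖z‖ < (q ^ k)⁻¹ * ε) :
    (∀ ω ∈ Metric.sphere (0 : ℂ) ε, ∀ α : ℝ, Admissible ω α →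
      RayIntegrable α (qKernel q k z ω)) ∧
    ∀ θ : ℂ → ℝ, (∀ᵐ t : ℝ, Admissible (circleMap 0 ε t) (θ (circleMap 0 ε t))) →
      CircleIntegrable (fun ω => f ω * rayIntegral (θ ω) (qKernel q k z ω)) 0 ε ∧
      (jacksonDeriv q)^[k] f z = qCauchyIntegral q f ε k θ z ∧
      (pqDeriv 1 q)^[k] f z = qCauchyIntegral q f ε k θ z ∧
      HasSum (fun n : ℕ =>
          PowerSeries.coeff n ((momentDeriv (qFactorial q))^[k] (maclaurin f)) * z ^ n)
        (qCauchyIntegral q f ε k θ z) := by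
  have hqk : 0 < q ^ k := pow_pos (one_pos.trans hq) k
  have hz' : q ^ k * ‖z‖ < ε := (lt_inv_mul_iff₀ hqk).mp hz
  refine ⟨fun ω hω α hα => rayIntegrable_qKernel hq (by rwa [mem_sphere_zero_iff_norm.mp hω]) hα,
    fun θ hθ => ?_⟩
  have hjackson : (jacksonDeriv q)^[k] f z = qCauchyIntegral q f ε k θ z := by
    rw [iterate_jacksonDeriv_eq_circleIntegral hq hf hz',
      qCauchyIntegral_eq_circleIntegral hq hz' f hθ]
  have hsum := (hasSumOnDisc_maclaurin hf.differentiableOn).iterate_jacksonDeriv hq k z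
    ((lt_div_iff₀' hqk).mpr hz')
  refine ⟨circleIntegrable_mul_rayIntegral_qKernel hq
    (hf.continuousOn_ball.mono Metric.sphere_subset_closedBall) hz' hθ, hjackson, ?_, ?_⟩
  · rw [pqDeriv_one_left, hjackson]
  · rwa [← hjackson]

theorem theorem2 (q : ℝ) (hq : 1 < q) (r : ℝ) (f : ℂ → ℂ)
    (hf : DifferentiableOn ℂ f (Metric.ball 0 r))
    (ε : ℝ) (hε : 0 < ε) (hεr : ε < r) (k : ℕ) (z : ℂ) (hz : ‖z‖ < (q ^ k)⁻¹ * ε) :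
    -- the inner integral converges absolutely in every admissible direction
    (∀ ω ∈ Metric.sphere (0 : ℂ) ε, ∀ α : ℝ, Admissible ω α →
      RayIntegrable α (qKernel q k z ω)) ∧
    -- directions may depend on `ω`; a constant direction is inadmissible for exactly one `ω`
    ∀ θ : ℂ → ℝ, {ω ∈ Metric.sphere (0 : ℂ) ε | ¬ Admissible ω (θ ω)}.Countable →
      CircleIntegrable (fun ω => f ω * rayIntegral (θ ω) (qKernel q k z ω)) 0 ε ∧
      (jacksonDeriv q)^[k] f z = qCauchyIntegral q f ε k θ z ∧
      (pqDeriv 1 q)^[k] f z = qCauchyIntegral q f ε k θ z ∧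
      HasSum (fun n : ℕ =>
          PowerSeries.coeff n ((momentDeriv (qFactorial q))^[k] (maclaurin f)) * z ^ n)
        (qCauchyIntegral q f ε k θ z) := by
  have h := theorem2_general q hq f ε
    (hf.diffContOnCl_ball (Metric.closedBall_subset_ball hεr)) k z hz
  exact ⟨h.1, fun θ hθ => h.2 θ (ae_admissible_of_countable hε hθ)⟩
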